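/- Let $(\Lambda,+,\le)$ be an ordered (i.e. linearly ordered) abelian group and let $\mathrm{Aut}^+(\Lambda)$ be the group of its order-preserving group automorphisms. Let $(X,d)$ be a $\Lambda$-tree, that is, a $\Lambda$-metric space that is geodesic (any two points $x,y$ are joined by an isometric copy of the interval $[0,d(x,y)]_\Lambda$), in which all Gromov products $(x\cdot y)_v=\tfrac12\bigl(d(x,v)+d(y,v)-d(x,y)\bigr)$ lie in $\Lambda$, and which is $0$-hyperbolic, that is, $(x\cdot y)_v\ge\min\{(x\cdot z)_v,(y\cdot z)_v\}$ for all $x,y,z,v\in X$. An isometry $g$ of $X$ is an *inversion* if $g$ has no fixed point but $g^2$ has one, and it is *hyperbolic* if it has no fixed point and is not an inversion. Its *hyperbolic length* is $\ell(g)=0$ if $g$ is an inversion, and $\ell(g)=\min\{d(x,gx):x\in X\}$ otherwise. An isometric action of a group $H$ on $X$ is *minimal* if $X$ has no proper non-empty $H$-invariant subtree (a subtree is a subset $S$ containing $[x,y]=\{z:d(x,z)+d(z,y)=d(x,y)\}$ for all $x,y\in S$); it is *abelian* if $\ell(gh)\le\ell(g)+\ell(h)$ for all $g,h\in H$; and it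 is *dihedral* if it is non-abelian but $\ell(gh)\le\ell(g)+\ell(h)$ for all $g,h\in H$ that act as hyperbolic isometries. Given a homomorphism $\alpha:G\to\mathrm{Aut}^+(\Lambda)$, $g\mapsto\alpha_g$, an action of a group $G$ on $X$ is *$\alpha$-affine* if $d(gx,gy)=\alpha_g\,d(x,y)$ for all $g\in G$ and $x,y\in X$. **Theorem.** Let $G$ be a group and $N$ a normal subgroup of $G$. Suppose that $N$ has a minimal non-abelian isometric action on the $\Lambda$-tree $X$, and, in case this action is dihedral, that no element of $N$ acts as an inversion. Let $\ell$ be the hyperbolic length function of this action, and let $\alpha:G\to\mathrm{Aut}^+(\Lambda)$ be a homomorphism with $N\le\ker\alpha$. Then there is an $\alpha$-affine action of $G$ on $X$ that extends the given action of $N$ if and only if $$\ell(\gamma g\gamma^{-1})=\alpha_\gamma\,\ell(g)\qquad\text{for all } g\in N \text{ and } \gamma\in G.$$ -/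

import Mathlib

/-- The group `Aut⁺(Λ)` of order-preserving group automorphisms of an ordered abelian group `Λ`,
with composition as multiplication. -/
instance orderAutGroup (Λ : Type*) [AddCommGroup Λ] [LinearOrder Λ] : Group (Λ ≃+o Λ) where
  mul f g := g.trans f
  one := OrderAddMonoidIso.refl Λ
  inv f := f.symm
  mul_assoc _ _ _ := rfl
  one_mul _ := rfl
  mul_one _ := rfl
  inv_mul_cancel f := by
    apply DFunLike.ext
    exact fun x => f.toEquiv.symm_apply_apply x

/-- A `Λ`-metric on `X`. -/
structure LambdaMetric (Λ : Type*) [AddCommGroup Λ] [LinearOrder Λ] (X : Type*) where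
  dist : X → X → Λ
  nonneg : ∀ x y, 0 ≤ dist x y
  eq_zero_iff : ∀ x y, dist x y = 0 ↔ x = y
  symm : ∀ x y, dist x y = dist y x
  triangle : ∀ x y z, dist x z ≤ dist x y + dist y z

namespace LambdaMetric

variable {Λ : Type*} [AddCommGroup Λ] [LinearOrder Λ] {X : Type*}

/-- Any two points are joined by a segment, that is, by an isometric copy of the interval
`[0, d(x, y)]` of `Λ`. -/
def IsGeodesic (d : LambdaMetric Λ X) : Prop :=
  ∀ x y : X, ∃ f : Λ → X, f 0 = x ∧ f (d.dist x y) = y ∧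
    ∀ s ∈ Set.Icc 0 (d.dist x y), ∀ t ∈ Set.Icc 0 (d.dist x y), d.dist (f s) (f t) = |s - t|

/-- Twice the Gromov product, `2 (x · y)_v = d(x, v) + d(y, v) - d(x, y)`. -/
def twiceGromov (d : LambdaMetric Λ X) (v x y : X) : Λ :=
  d.dist x v + d.dist y v - d.dist x y

/-- `(X, d)` is a `Λ`-tree: it is geodesic, all Gromov products `(x · y)_v` lie in `Λ`, and it is
`0`-hyperbolic with respect to every point `v`, that is,
`(x · y)_v ≥ min ((x · z)_v, (y · z)_v)` (written here after doubling). -/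
structure IsTree (d : LambdaMetric Λ X) : Prop where
  geodesic : d.IsGeodesic
  gromov_mem : ∀ v x y : X, ∃ c : Λ, c + c = d.twiceGromov v x y
  hyperbolic : ∀ v x y z : X,
    min (d.twiceGromov v x z) (d.twiceGromov v y z) ≤ d.twiceGromov v x y

/-- The segment `[x, y]`. -/
def segment (d : LambdaMetric Λ X) (x y : X) : Set X :=
  {z | d.dist x z + d.dist z y = d.dist x y}

/-- A subtree: a subset containing the segment joining any two of its points. -/
def IsSubtree (d : LambdaMetric Λ X) (S : Set X) : Prop :=
  ∀ x ∈ S, ∀ y ∈ S, d.segment x y ⊆ S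

/-- `g` is an inversion: `g` has no fixed point, but `g²` has one. -/
def IsInversion (g : Equiv.Perm X) : Prop :=
  (∀ x, g x ≠ x) ∧ ∃ x, g (g x) = x

/-- An isometry `g` of a `Λ`-tree is hyperbolic: it has no fixed point and is not an inversion. -/
def IsHyperbolic (g : Equiv.Perm X) : Prop :=
  (∀ x, g x ≠ x) ∧ ¬ IsInversion g

open Classical in
/-- The hyperbolic length (translation length) `ℓ(g)` of an isometry `g` of a `Λ`-tree: it is
`0` if `g` is an inversion, and `min {d(x, g x) : x ∈ X}` otherwise. (This minimum always exists
for an isometry of a nonempty `Λ`-tree that is not an inversion; the value `0` in the remaining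
case is a dummy.) -/
noncomputable def hyperbolicLength (d : LambdaMetric Λ X) (g : Equiv.Perm X) : Λ :=
  if IsInversion g then 0
  else if h : ∃ m, IsLeast (Set.range fun x => d.dist x (g x)) m then h.choose
  else 0

variable {G : Type*} [Group G]

/-- An action `ρ` of `G` on `X` is isometric. -/
def IsIsometricAction (d : LambdaMetric Λ X) (ρ : G →* Equiv.Perm X) : Prop :=
  ∀ (g : G) (x y : X), d.dist (ρ g x) (ρ g y) = d.dist x y

/-- An action `ρ` of `G` on `X` is `α`-affine: `d(g x, g y) = α_g d(x, y)`. -/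
def IsAffineAction (d : LambdaMetric Λ X) (α : G →* (Λ ≃+o Λ)) (ρ : G →* Equiv.Perm X) : Prop :=
  ∀ (g : G) (x y : X), d.dist (ρ g x) (ρ g y) = α g (d.dist x y)

/-- An action is minimal: there is no proper nonempty invariant subtree. -/
def IsMinimalAction (d : LambdaMetric Λ X) (ρ : G →* Equiv.Perm X) : Prop :=
  ∀ S : Set X, S.Nonempty → d.IsSubtree S → (∀ g : G, ∀ x ∈ S, ρ g x ∈ S) → S = Set.univ

/-- An isometric action is abelian: `ℓ(gh) ≤ ℓ(g) + ℓ(h)` for all `g, h`. -/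
def IsAbelianAction (d : LambdaMetric Λ X) (ρ : G →* Equiv.Perm X) : Prop :=
  ∀ g h : G, d.hyperbolicLength (ρ (g * h)) ≤
    d.hyperbolicLength (ρ g) + d.hyperbolicLength (ρ h)

/-- An isometric action is dihedral: it is not abelian, but `ℓ(gh) ≤ ℓ(g) + ℓ(h)` for all
hyperbolic `g, h`. -/
def IsDihedralAction (d : LambdaMetric Λ X) (ρ : G →* Equiv.Perm X) : Prop :=
  ¬ d.IsAbelianAction ρ ∧
    ∀ g h : G, IsHyperbolic (ρ g) → IsHyperbolic (ρ h) →
      d.hyperbolicLength (ρ (g * h)) ≤ d.hyperbolicLength (ρ g) + d.hyperbolicLength (ρ h)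

end LambdaMetric

namespace LambdaMetric

/-! Necessity: an affine map intertwining two isometries scales every displacement, hence the
length. Sufficiency: for fixed `γ`, compare `N` acting by `ρ` on the tree rescaled by `α γ` with `N`
acting on the original tree by `ρ` precomposed with conjugation by `γ`. By hypothesis both have the
same length function, and an equivariant isometry between them is exactly the affine map wanted for
`γ`.

That isometry comes from a special point `x` whose displacements `d(x, n x)` are given by a formula
in the length function alone (`exists_displacement_of_length`). Non-abelianness yields `g`, `h` with
`ℓ(g) + ℓ(h) < ℓ(gh)`, so their characteristic sets are joined by a bridge, and `x` is its endpoint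
on the side of `g`. If `g`, `h` can be chosen hyperbolic, `x` lies strictly inside the bridge
between the axes of `h` and `ghg⁻¹`. Otherwise `g` fixes `x` and flips every axis about `x`. Equal
displacements make the two orbits isometric; by minimality segments between orbit points cover the
tree, so the isometry extends (`exists_equivariant_isometry`).

The special point is determined by its displacements, so an isometry commuting with `N` fixes it.
The fixed set is an invariant subtree, hence everything (`eq_one_of_commute`). The affine map for
`γ` is therefore unique, which gives multiplicativity in `γ` and agreement with `ρ` on `N`. -/

/-- The point `v` lies on the segment `[x, y]`. For `x ≠ v ≠ y` in a tree this says that `x` and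
`y` lie in different directions at `v`. -/
def Between {Λ X : Type*} [AddCommGroup Λ] [LinearOrder Λ] (d : LambdaMetric Λ X) (x v y : X) :
    Prop :=
  d.dist x v + d.dist v y = d.dist x y

/-- `c` preserves the metric `d`. -/
def IsIsometric {Λ X : Type*} [AddCommGroup Λ] [LinearOrder Λ] (d : LambdaMetric Λ X)
    (c : Equiv.Perm X) : Prop :=
  ∀ x y, d.dist (c x) (c y) = d.dist x y

/-! ### Betweenness in trees -/

section Basic

variable {Λ : Type*} [AddCommGroup Λ] [LinearOrder Λ] [IsOrderedAddMonoid Λ] {X : Type*}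
  {d : LambdaMetric Λ X}

omit [IsOrderedAddMonoid Λ] in
theorem dist_self (x : X) : d.dist x x = 0 := (d.eq_zero_iff x x).2 rfl

omit [IsOrderedAddMonoid Λ] in
theorem dist_pos {x y : X} (h : x ≠ y) : 0 < d.dist x y :=
  lt_of_le_of_ne (d.nonneg x y) fun h' => h ((d.eq_zero_iff x y).1 h'.symm)

omit [IsOrderedAddMonoid Λ] in
theorem ne_of_dist_pos {x y : X} (h : 0 < d.dist x y) : x ≠ y := by
  rintro rfl
  exact h.ne' (dist_self x)

omit [IsOrderedAddMonoid Λ] in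
theorem Between.symm {x v y : X} (h : d.Between x v y) : d.Between y v x := by
  have h1 := d.symm x v
  have h2 := d.symm v y
  have h3 := d.symm x y
  unfold Between at *
  rw [← h1, ← h2, ← h3, add_comm]
  exact h

omit [IsOrderedAddMonoid Λ] in
theorem between_left (x y : X) : d.Between x x y := by
  simp [Between, dist_self]

omit [IsOrderedAddMonoid Λ] in
theorem not_between_iff {x v y : X} :
    ¬ d.Between x v y ↔ d.dist x y < d.dist x v + d.dist v y := by
  have := d.triangle x v y
  unfold Between
  grind

/-- Here `(x · y)_v = 0`, so by hyperbolicity the smaller of `(x · z)_v` and `(y · z)_v` vanishes: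
`z` cannot share its direction at `v` with both `x` and `y`. -/
theorem IsTree.between_or (hX : d.IsTree) {x v y : X} (h : d.Between x v y) (z : X) :
    d.Between x v z ∨ d.Between y v z := by
  have h1 := hX.hyperbolic v x y z
  have h2 := d.triangle x v z
  have h3 := d.triangle y v z
  have h4 := d.symm v y
  have h5 := d.symm v z
  unfold Between twiceGromov at *
  grind

theorem IsTree.between_of_not (hX : d.IsTree) {x v y z : X} (h : d.Between x v y)
    (hz : ¬ d.Between y v z) : d.Between x v z :=
  (hX.between_or h z).resolve_right hz

theorem IsTree.between_concat (hX : d.IsTree) {p x y q : X} (hxy : x ≠ y)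
    (h1 : d.Between p x y) (h2 : d.Between x y q) : d.Between p x q ∧ d.Between p y q := by
  have h3 : ¬ d.Between y x q := by
    rw [not_between_iff]
    have := dist_pos (d := d) hxy
    have := d.symm x y
    unfold Between at h2
    grind
  have h4 := hX.between_of_not h1 h3
  refine ⟨h4, ?_⟩
  unfold Between at *
  grind

theorem not_between_of_between {v y z : X} (h : d.Between v y z) (hvy : v ≠ y) :
    ¬ d.Between y v z := by
  rw [not_between_iff]
  have := dist_pos (d := d) hvy
  have := d.symm v y
  unfold Between at h
  grind

/-- Segments issuing from `v` coincide up to the Gromov product of their endpoints. -/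
theorem IsTree.eq_of_dist_eq (hX : d.IsTree) {v y w z z' : X} (hz : d.Between v z y)
    (hz' : d.Between v z' w) (heq : d.dist v z = d.dist v z')
    (hle : d.dist v z + d.dist v z ≤ d.twiceGromov v y w) : z = z' := by
  rw [← d.eq_zero_iff]
  have h1 := hX.hyperbolic v z z' y
  have h2 := hX.hyperbolic v z' y w
  have := d.nonneg z z'
  have := d.symm v z
  have := d.symm v z'
  have := d.symm v y
  have := d.symm v w
  unfold Between at *
  unfold twiceGromov at *
  grind

theorem IsTree.dist_eq_max (hX : d.IsTree) {x v y : X} (h : d.Between x v y) (z : X) :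
    d.dist v z = max (d.dist x z - d.dist x v) (d.dist y z - d.dist y v) := by
  have h0 := hX.between_or h z
  have := d.triangle x v z
  have := d.triangle y v z
  unfold Between at *
  grind

theorem IsTree.exists_between (hX : d.IsTree) {x y : X} {t : Λ} (h0 : 0 ≤ t)
    (h1 : t ≤ d.dist x y) : ∃ z, d.Between x z y ∧ d.dist x z = t := by
  obtain ⟨f, hf0, hf1, hf⟩ := hX.geodesic x y
  have ha := hf 0 ⟨le_rfl, h0.trans h1⟩ t ⟨h0, h1⟩
  have hb := hf t ⟨h0, h1⟩ _ ⟨h0.trans h1, le_rfl⟩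
  rw [hf0] at ha
  rw [hf1] at hb
  refine ⟨f t, ?_, ?_⟩
  · unfold Between
    rw [ha, hb, zero_sub, abs_neg, abs_of_nonneg h0, abs_sub_comm,
      abs_of_nonneg (sub_nonneg.2 h1)]
    abel
  · rw [ha, zero_sub, abs_neg, abs_of_nonneg h0]

theorem IsTree.exists_two_between (hX : d.IsTree) {x y : X} {s t : Λ} (h0 : 0 ≤ s) (hst : s ≤ t)
    (h1 : t ≤ d.dist x y) : ∃ z w, d.Between x z y ∧ d.Between x w y ∧ d.dist x z = s ∧
      d.dist x w = t ∧ d.dist z w = t - s := by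
  obtain ⟨w, hw, hwt⟩ := hX.exists_between (h0.trans hst) h1
  obtain ⟨z, hz, hzs⟩ := hX.exists_between (x := x) (y := w) h0 (hst.trans hwt.ge)
  refine ⟨z, w, ?_, hw, hzs, hwt, ?_⟩
  · have := d.triangle x z y
    have := d.triangle z w y
    unfold Between at *
    grind
  · unfold Between at *
    grind

omit [IsOrderedAddMonoid Λ] in
theorem IsIsometric.between_iff {c : Equiv.Perm X} (hc : d.IsIsometric c) {x v y : X} :
    d.Between (c x) (c v) (c y) ↔ d.Between x v y := by
  unfold Between
  rw [hc, hc, hc]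

omit [IsOrderedAddMonoid Λ] in
theorem IsIsometric.inv {c : Equiv.Perm X} (hc : d.IsIsometric c) : d.IsIsometric c⁻¹ := by
  intro x y
  have := hc (c⁻¹ x) (c⁻¹ y)
  simpa using this.symm

omit [IsOrderedAddMonoid Λ] in
theorem IsIsometric.mul {b c : Equiv.Perm X} (hb : d.IsIsometric b) (hc : d.IsIsometric c) :
    d.IsIsometric (b * c) := by
  intro x y
  simp only [Equiv.Perm.mul_apply]
  rw [hb, hc]

omit [IsOrderedAddMonoid Λ] in
theorem IsIsometric.dist_inv_left {c : Equiv.Perm X} (hc : d.IsIsometric c) (x y : X) :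
    d.dist (c⁻¹ x) y = d.dist x (c y) := by
  have := hc (c⁻¹ x) y
  simpa using this.symm

omit [IsOrderedAddMonoid Λ] in
theorem IsIsometric.dist_inv_right {c : Equiv.Perm X} (hc : d.IsIsometric c) (x y : X) :
    d.dist x (c⁻¹ y) = d.dist (c x) y := by
  have := hc x (c⁻¹ y)
  simpa using this.symm

omit [IsOrderedAddMonoid Λ] in
theorem IsIsometric.dist_inv_self {c : Equiv.Perm X} (hc : d.IsIsometric c) (x : X) :
    d.dist x (c⁻¹ x) = d.dist x (c x) := by
  rw [hc.dist_inv_right, d.symm]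

end Basic

end LambdaMetric

namespace LambdaMetric

/-! ### Hyperbolic length of a single isometry -/

section Length

variable {Λ : Type*} [AddCommGroup Λ] [LinearOrder Λ] [IsOrderedAddMonoid Λ] {X : Type*}
  {d : LambdaMetric Λ X}

theorem IsTree.dist_le_of_between (hX : d.IsTree) {c : Equiv.Perm X} (hc : d.IsIsometric c) {p : X}
    (hb : d.Between p (c p) (c (c p))) (y : X) : d.dist p (c p) ≤ d.dist y (c y) := by
  rcases hX.between_or hb y with h | h
  · have h1 := hc p y
    have h2 := d.triangle (c p) y (c y)
    have h3 := d.symm y (c y)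
    unfold Between at h
    grind
  · have h1 := hc (c p) y
    have h2 := d.triangle (c p) (c y) y
    have h3 := d.symm y (c y)
    have h4 := hc (c p) p
    have h5 := hc p (c p)
    have h6 := hc p y
    have h7 := d.symm (c (c p)) (c p)
    have h8 := d.triangle (c (c p)) (c y) y
    unfold Between at h
    grind

theorem IsTree.apply_apply_ne_of_between (hX : d.IsTree) {c : Equiv.Perm X}
    (hc : d.IsIsometric c) {p : X} (hp : p ≠ c p) (hb : d.Between p (c p) (c (c p))) (y : X) :
    c (c y) ≠ y := by
  intro hy
  have h0 := dist_pos (d := d) hp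
  have e1 := hc p (c y)
  have e2 := hc p y
  have e3 := hc (c p) y
  have e4 := hc (c p) (c y)
  have e5 := hc p (c p)
  have e6 := d.symm (c p) (c (c p))
  rw [hy] at e1 e4
  rcases hX.between_or hb y with h | h <;> rcases hX.between_or hb (c y) with h' | h' <;>
    unfold Between at h h' <;> grind

omit [IsOrderedAddMonoid Λ] in
theorem hyperbolicLength_eq_of_isLeast {c : Equiv.Perm X} {m : Λ} (hinv : ¬ IsInversion c)
    (hm : IsLeast (Set.range fun x => d.dist x (c x)) m) : d.hyperbolicLength c = m := by
  have h : ∃ m, IsLeast (Set.range fun x => d.dist x (c x)) m := ⟨m, hm⟩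
  unfold hyperbolicLength
  rw [if_neg hinv, dif_pos h]
  exact h.choose_spec.unique hm

omit [IsOrderedAddMonoid Λ] in
theorem hyperbolicLength_eq_zero_of_apply_eq {c : Equiv.Perm X} {x : X} (hx : c x = x) :
    d.hyperbolicLength c = 0 := by
  apply hyperbolicLength_eq_of_isLeast
  · exact fun h => h.1 x hx
  · refine ⟨⟨x, ?_⟩, ?_⟩
    · simp [hx, dist_self]
    · rintro _ ⟨y, rfl⟩
      exact d.nonneg _ _

omit [IsOrderedAddMonoid Λ] in
theorem hyperbolicLength_eq_zero_of_apply_apply_eq {c : Equiv.Perm X} {x : X}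
    (hx : c (c x) = x) : d.hyperbolicLength c = 0 := by
  by_cases h : ∃ y, c y = y
  · obtain ⟨y, hy⟩ := h
    exact hyperbolicLength_eq_zero_of_apply_eq hy
  · push Not at h
    unfold hyperbolicLength
    rw [if_pos ⟨h, x, hx⟩]

theorem IsTree.hyperbolicLength_eq_of_between (hX : d.IsTree) {c : Equiv.Perm X}
    (hc : d.IsIsometric c) {p : X} (hp : p ≠ c p) (hb : d.Between p (c p) (c (c p))) :
    d.hyperbolicLength c = d.dist p (c p) := by
  apply hyperbolicLength_eq_of_isLeast
  · rintro ⟨_, y, hy⟩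
    exact hX.apply_apply_ne_of_between hc hp hb y hy
  · refine ⟨⟨p, rfl⟩, ?_⟩
    rintro _ ⟨y, rfl⟩
    exact hX.dist_le_of_between hc hb y

theorem IsTree.exists_axis_proj (hX : d.IsTree) {c : Equiv.Perm X} (hc : d.IsIsometric c) {y : X}
    (h : d.dist y (c y) < d.dist y (c (c y))) :
    ∃ p, p ≠ c p ∧ d.Between p (c p) (c (c p)) ∧
      d.dist p (c p) = d.dist y (c (c y)) - d.dist y (c y) ∧
      d.dist y (c y) = d.dist p (c p) + (d.dist y p + d.dist y p) := by
  obtain ⟨δ, hδ⟩ := hX.gromov_mem (c y) y (c (c y))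
  have e1 := hc y (c y)
  have e2 := d.symm (c y) (c (c y))
  have e3 := d.triangle y (c y) (c (c y))
  unfold twiceGromov at hδ
  -- `[c y, y]` and `[c y, c² y]` share an initial piece of length `δ`. Cutting `δ` off both ends of
  -- `[y, c y]` leaves `[p, q]` with `q = c p`, a piece of the axis.
  obtain ⟨p, q, hp, hq, hyp, hyq, hpq⟩ := hX.exists_two_between (x := y) (y := c y) (s := δ)
    (t := d.dist y (c y) - δ) (by grind) (by grind) (by grind)
  have e4 := hc y p
  have e5 := d.symm q (c y)
  have e6 := d.symm y (c y)
  have hqc : q = c p := by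
    apply hX.eq_of_dist_eq (v := c y) (y := y) (w := c (c y)) hq.symm (hc.between_iff.2 hp)
    · unfold Between at hq
      grind
    · unfold Between at hq
      unfold twiceGromov
      grind
  subst hqc
  have e7 := hc p (c p)
  have e8 := d.triangle y p (c (c p))
  have e9 := d.triangle y (c (c p)) (c (c y))
  have e10 := hc (c p) (c y)
  have e11 := d.symm (c (c p)) (c (c y))
  have e12 := d.triangle p (c p) (c (c p))
  have e13 := d.symm (c p) (c y)
  have e14 := d.nonneg y (c y)
  refine ⟨p, ne_of_dist_pos (d := d) ?_, ?_, ?_, ?_⟩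
  · grind
  · unfold Between
    grind
  · grind
  · grind

/-- The overlap now reaches at least halfway along `[y, c y]`, and `c` reverses the middle part. The
midpoint may be missing when `Λ` is not 2-divisible, so a swapped pair is produced instead of a
fixed point. -/
theorem IsTree.exists_apply_apply_eq (hX : d.IsTree) {c : Equiv.Perm X} (hc : d.IsIsometric c)
    {y : X} (h : d.dist y (c (c y)) ≤ d.dist y (c y)) : ∃ q, c (c q) = q := by
  obtain ⟨δ, hδ⟩ := hX.gromov_mem (c y) y (c (c y))
  have e1 := hc y (c y)
  have e2 := d.symm (c y) (c (c y))
  have e3 := d.triangle y (c y) (c (c y))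
  have e4 := d.nonneg y (c (c y))
  unfold twiceGromov at hδ
  obtain ⟨p, q, hp, hq, hyp, hyq, hpq⟩ := hX.exists_two_between (x := y) (y := c y)
    (s := d.dist y (c y) - δ) (t := δ) (by grind) (by grind) (by grind)
  have e5 := d.symm q (c y)
  have e6 := d.symm y (c y)
  have e7 := d.symm p (c y)
  have e8 := hc y q
  have e9 := hc y p
  have h1 : p = c q := by
    apply hX.eq_of_dist_eq (v := c y) (y := y) (w := c (c y)) hp.symm (hc.between_iff.2 hq)
    · unfold Between at hp hq
      grind
    · unfold Between at hp hq
      unfold twiceGromov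
      grind
  have h2 : q = c p := by
    apply hX.eq_of_dist_eq (v := c y) (y := y) (w := c (c y)) hq.symm (hc.between_iff.2 hp)
    · unfold Between at hp hq
      grind
    · unfold Between at hp hq
      unfold twiceGromov
      grind
  exact ⟨q, by rw [← h1, ← h2]⟩

/-- The hyperbolic length is determined by the displacements of any point under `c` and `c²`. -/
theorem IsTree.hyperbolicLength_eq (hX : d.IsTree) {c : Equiv.Perm X} (hc : d.IsIsometric c)
    (y : X) : d.hyperbolicLength c = max 0 (d.dist y (c (c y)) - d.dist y (c y)) := by
  rcases lt_or_ge (d.dist y (c y)) (d.dist y (c (c y))) with h | h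
  · obtain ⟨p, hp, hb, hd, -⟩ := hX.exists_axis_proj hc h
    rw [hX.hyperbolicLength_eq_of_between hc hp hb, hd, max_eq_right (sub_nonneg.2 h.le)]
  · obtain ⟨q, hq⟩ := hX.exists_apply_apply_eq hc h
    rw [hyperbolicLength_eq_zero_of_apply_apply_eq hq, max_eq_left (sub_nonpos.2 h)]

theorem IsTree.hyperbolicLength_le (hX : d.IsTree) {c : Equiv.Perm X} (hc : d.IsIsometric c)
    (y : X) : d.hyperbolicLength c ≤ d.dist y (c y) := by
  rw [hX.hyperbolicLength_eq hc y]
  have h1 := d.triangle y (c y) (c (c y))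
  have h2 := hc y (c y)
  have h3 := d.nonneg y (c y)
  grind

theorem IsTree.hyperbolicLength_nonneg (hX : d.IsTree) [Nonempty X] {c : Equiv.Perm X}
    (hc : d.IsIsometric c) : 0 ≤ d.hyperbolicLength c := by
  rw [hX.hyperbolicLength_eq hc (Classical.arbitrary X)]
  exact le_max_left _ _

theorem IsTree.hyperbolicLength_mul_comm (hX : d.IsTree) [Nonempty X] {a b : Equiv.Perm X}
    (ha : d.IsIsometric a) (hb : d.IsIsometric b) :
    d.hyperbolicLength (a * b) = d.hyperbolicLength (b * a) := by
  let y : X := Classical.arbitrary X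
  rw [hX.hyperbolicLength_eq (ha.mul hb) y, hX.hyperbolicLength_eq (hb.mul ha) (b y)]
  simp only [Equiv.Perm.mul_apply, hb _ _]

theorem IsTree.hyperbolicLength_conj (hX : d.IsTree) [Nonempty X] {a b : Equiv.Perm X}
    (ha : d.IsIsometric a) (hb : d.IsIsometric b) :
    d.hyperbolicLength (a * b * a⁻¹) = d.hyperbolicLength b := by
  rw [hX.hyperbolicLength_mul_comm (ha.mul hb) ha.inv, inv_mul_cancel_left]

theorem IsTree.hyperbolicLength_inv (hX : d.IsTree) [Nonempty X] {a : Equiv.Perm X}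
    (ha : d.IsIsometric a) : d.hyperbolicLength a⁻¹ = d.hyperbolicLength a := by
  let y : X := Classical.arbitrary X
  rw [hX.hyperbolicLength_eq ha.inv y, hX.hyperbolicLength_eq ha y, ha.dist_inv_self,
    ha.dist_inv_right, ha.dist_inv_right, d.symm _ y]

theorem IsTree.hyperbolicLength_pos_iff (hX : d.IsTree) [Nonempty X] {c : Equiv.Perm X}
    (hc : d.IsIsometric c) : 0 < d.hyperbolicLength c ↔ IsHyperbolic c := by
  constructor
  · intro h
    refine ⟨fun x hx => h.ne' (hyperbolicLength_eq_zero_of_apply_eq hx), ?_⟩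
    rintro ⟨-, x, hx⟩
    exact h.ne' (hyperbolicLength_eq_zero_of_apply_apply_eq hx)
  · rintro ⟨h1, h2⟩
    by_contra h
    let y : X := Classical.arbitrary X
    rw [hX.hyperbolicLength_eq hc y, lt_max_iff, sub_pos] at h
    push Not at h
    exact h2 ⟨h1, hX.exists_apply_apply_eq hc h.2⟩

/-- Any point has a projection to the characteristic set of an isometry that is not an
inversion. -/
theorem IsTree.exists_proj (hX : d.IsTree) {c : Equiv.Perm X} (hc : d.IsIsometric c)
    (hinv : ¬ IsInversion c) (y : X) : ∃ x, d.dist x (c x) = d.hyperbolicLength c ∧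
      d.dist y (c y) = d.hyperbolicLength c + (d.dist y x + d.dist y x) := by
  rcases lt_or_ge (d.dist y (c y)) (d.dist y (c (c y))) with h | h
  · obtain ⟨p, hp, hb, hd, hy⟩ := hX.exists_axis_proj hc h
    rw [hX.hyperbolicLength_eq_of_between hc hp hb]
    exact ⟨p, rfl, hy⟩
  · obtain ⟨q, hq⟩ := hX.exists_apply_apply_eq hc h
    have hfix : ∃ r, c r = r := by
      by_contra hr
      push Not at hr
      exact hinv ⟨hr, q, hq⟩
    obtain ⟨r, hr⟩ := hfix
    obtain ⟨δ, hδ⟩ := hX.gromov_mem r y (c y)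
    have e1 := hc y r
    have e2 := d.nonneg y (c y)
    have e3 := hc y (c y)
    have e4 := d.symm (c y) (c (c y))
    rw [hr] at e1
    unfold twiceGromov at hδ
    -- The centre of the tripod `r`, `y`, `c y`; since `r` is equidistant from `y` and `c y`, it is
    -- the midpoint of `[y, c y]`.
    obtain ⟨x, hx, hxy⟩ := hX.exists_between (x := y) (y := c y) (t := d.dist y r - δ)
      (by grind) (by grind)
    have e5 := hc y x
    have e6 := d.symm x (c y)
    have e7 := d.symm y (c y)
    have h1 : x = c x := by
      apply hX.eq_of_dist_eq (v := c y) (y := y) (w := c (c y)) hx.symm (hc.between_iff.2 hx)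
      · unfold Between at hx
        grind
      · unfold Between at hx
        unfold twiceGromov
        grind
    refine ⟨x, ?_, ?_⟩
    · rw [← h1, dist_self, hyperbolicLength_eq_zero_of_apply_eq h1.symm]
    · rw [hyperbolicLength_eq_zero_of_apply_eq h1.symm]
      grind

end Length

end LambdaMetric

namespace LambdaMetric

/-! ### Products of two isometries and bridges -/

section Pairs

variable {Λ : Type*} [AddCommGroup Λ] [LinearOrder Λ] [IsOrderedAddMonoid Λ] {X : Type*}
  {d : LambdaMetric Λ X}

omit [IsOrderedAddMonoid Λ] in
theorem IsIsometric.between_inv_left {c : Equiv.Perm X} (hc : d.IsIsometric c) {x v y : X} :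
    d.Between (c⁻¹ x) v y ↔ d.Between x (c v) (c y) := by
  rw [← hc.between_iff]
  simp

omit [IsOrderedAddMonoid Λ] in
theorem IsIsometric.between_inv_right {c : Equiv.Perm X} (hc : d.IsIsometric c) {x v y : X} :
    d.Between x v (c⁻¹ y) ↔ d.Between (c x) (c v) y := by
  rw [← hc.between_iff]
  simp

/-- Off the characteristic set, `c x` and `c⁻¹ x` leave `x` in the same direction, towards that set.
-/
theorem IsTree.not_between_inv (hX : d.IsTree) {c : Equiv.Perm X} (hc : d.IsIsometric c) {x : X}
    (h : d.hyperbolicLength c < d.dist x (c x)) : ¬ d.Between (c x) x (c⁻¹ x) := by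
  rw [not_between_iff, hc.dist_inv_self, hc.dist_inv_right, d.symm (c x) x, d.symm _ x]
  have h1 := hX.hyperbolicLength_eq hc x
  grind

theorem IsTree.between_inv_of_eq (hX : d.IsTree) {c : Equiv.Perm X} (hc : d.IsIsometric c) {x : X}
    (h : d.dist x (c x) = d.hyperbolicLength c) (h0 : 0 < d.hyperbolicLength c) :
    d.Between (c x) x (c⁻¹ x) := by
  unfold Between
  rw [hc.dist_inv_self, hc.dist_inv_right, d.symm (c x) x, d.symm _ x]
  have h1 := hX.hyperbolicLength_eq hc x
  grind

theorem IsTree.between_of_between (hX : d.IsTree) {c : Equiv.Perm X} (hc : d.IsIsometric c)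
    {p x : X} (hx : x ≠ c x) (h1 : d.Between p x (c x)) (h2 : d.Between p x (c⁻¹ x)) :
    d.Between p x (c p) ∧ d.Between p (c x) (c p) ∧
      d.dist p (c p) = d.dist x (c x) + (d.dist p x + d.dist p x) := by
  have h3 : d.Between x (c x) (c p) := by
    have := hc.between_inv_right.1 h2
    exact this.symm
  obtain ⟨h4, h5⟩ := hX.between_concat hx h1 h3
  refine ⟨h4, h5, ?_⟩
  have h6 := hc x p
  have h7 := d.symm x p
  unfold Between at *
  grind

theorem IsTree.dist_apply_of_between (hX : d.IsTree) {c : Equiv.Perm X} (hc : d.IsIsometric c)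
    {p x : X} (hx : d.hyperbolicLength c < d.dist x (c x)) (h1 : d.Between p x (c x)) :
    d.Between p x (c p) ∧ d.Between p (c x) (c p) ∧
      d.dist p (c p) = d.dist x (c x) + (d.dist p x + d.dist p x) := by
  have : Nonempty X := ⟨x⟩
  apply hX.between_of_between hc (ne_of_dist_pos (d := d)
    ((hX.hyperbolicLength_nonneg hc).trans_lt hx)) h1
  exact hX.between_of_not h1 (hX.not_between_inv hc hx)

/-- The path `x`, `a x`, `ab x`, `aba x`, `abab x` does not backtrack at any vertex, so `x` lies on
the axis of `ab`. -/
theorem IsTree.hyperbolicLength_mul (hX : d.IsTree) {a b : Equiv.Perm X} (ha : d.IsIsometric a)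
    (hb : d.IsIsometric b) {x : X} (hax : x ≠ a x) (hbx : x ≠ b x)
    (h1 : d.Between (a⁻¹ x) x (b x)) (h2 : d.Between (b⁻¹ x) x (a x)) :
    d.hyperbolicLength (a * b) = d.dist x (a x) + d.dist x (b x) := by
  have k1 : d.Between x (a x) (a (b x)) := ha.between_inv_left.1 h1
  have k2 : d.Between x (b x) (b (a x)) := hb.between_inv_left.1 h2
  have k3 : d.Between (a x) (a (b x)) (a (b (a x))) := ha.between_iff.2 k2
  have k4 : d.Between (a (b x)) (a (b (a x))) (a (b (a (b x)))) :=
    ha.between_iff.2 (hb.between_iff.2 k1)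
  have n1 : a x ≠ a (b x) := fun h => hbx (a.injective h)
  have n2 : a (b x) ≠ a (b (a x)) := fun h => hax (b.injective (a.injective h))
  have k5 := (hX.between_concat n1 k1 k3).2
  have k6 := (hX.between_concat n2 k5 k4).1
  have k7 : d.dist x (a (b x)) = d.dist x (a x) + d.dist x (b x) := by
    rw [← k1, ha]
  rw [← k7]
  apply hX.hyperbolicLength_eq_of_between (ha.mul hb) _ k6
  apply ne_of_dist_pos (d := d)
  have := dist_pos (d := d) hax
  have := dist_pos (d := d) hbx
  simp only [Equiv.Perm.mul_apply]
  grind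

/-- The endpoint, in the characteristic set of `g`, of the bridge joining disjoint characteristic
sets. -/
theorem IsTree.exists_bridge (hX : d.IsTree) [Nonempty X] {g h : Equiv.Perm X}
    (hg : d.IsIsometric g) (hh : d.IsIsometric h) (hgi : ¬ IsInversion g) (hhi : ¬ IsInversion h)
    (hlt : d.hyperbolicLength g + d.hyperbolicLength h < d.hyperbolicLength (g * h)) :
    ∃ x, d.dist x (g x) = d.hyperbolicLength g ∧ d.hyperbolicLength h < d.dist x (h x) ∧
      d.hyperbolicLength (g * h) = d.dist x (g x) + d.dist x (h x) ∧
      d.Between (g x) x (h x) ∧ d.Between (g⁻¹ x) x (h x) := by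
  obtain ⟨y, hy, -⟩ := hX.exists_proj hh hhi (Classical.arbitrary X)
  obtain ⟨x, hx, hyx⟩ := hX.exists_proj hg hgi y
  have hle : ∀ z, d.hyperbolicLength (g * h) ≤ d.dist z (g z) + d.dist z (h z) := by
    intro z
    have h1 := hX.hyperbolicLength_le (hg.mul hh) z
    have h2 := d.triangle z (g z) (g (h z))
    have h3 := hg z (h z)
    simp only [Equiv.Perm.mul_apply] at h1
    grind
  have hhx : d.hyperbolicLength h < d.dist x (h x) := by
    have := hle x
    grind
  have hyx0 : 0 < d.dist y x := by
    have := hle y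
    have := d.nonneg y x
    grind
  -- Were `y` and `h x` in different directions at `x`, `h` would move `y` further than `x`,
  -- although `y` has minimal displacement.
  have hnb : ¬ d.Between y x (h x) := by
    intro hb
    have := (hX.dist_apply_of_between hh hhx hb).2.2
    grind
  have hnb' : ¬ d.Between y x (h⁻¹ x) := by
    intro hb
    exact hX.not_between_inv hh hhx ((hX.between_of_not hb.symm hnb).symm)
  have e1 := hg x y
  have e2 := d.symm x y
  have e3 := d.triangle y x (g x)
  have e4 := d.triangle y (g x) (g y)
  have e5 := d.triangle x (g x) (g y)
  have e6 := d.triangle y x (g y)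
  have b1 : d.Between y x (g x) := by unfold Between; grind
  have b2 : d.Between x (g x) (g y) := by unfold Between; grind
  have b3 : d.Between y x (g y) := by unfold Between; grind
  have b4 : d.Between (g⁻¹ x) x y := hg.between_inv_left.2 b2
  have c1 : d.Between (g x) x (h x) := hX.between_of_not b1.symm hnb
  have c2 : d.Between (g⁻¹ x) x (h x) := hX.between_of_not b4 hnb
  have c3 : d.Between (g x) x (h⁻¹ x) := hX.between_of_not b1.symm hnb'
  have hh0 : x ≠ h x :=
    ne_of_dist_pos (d := d) ((hX.hyperbolicLength_nonneg hh).trans_lt hhx)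
  refine ⟨x, hx, hhx, ?_, c1, c2⟩
  -- If `g` fixes `x`, `hyperbolicLength_mul` does not apply, and the alignment of `x`, `gh x`,
  -- `(gh)² x` is checked directly.
  by_cases hgx : x = g x
  · have c4 : d.Between (h⁻¹ x) x (g y) := (hX.between_of_not b3.symm hnb').symm
    have hnb'' : ¬ d.Between (g y) x (g (h x)) := by
      have := mt (hg.between_iff (x := y) (v := x) (y := h x)).1 hnb
      rwa [← hgx] at this
    have c5 := hX.between_of_not c4 hnb''
    have c6 : d.Between x (g (h x)) (g (h (g (h x)))) := by
      have := (hg.mul hh).between_iff.2 c5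
      simpa [← hgx] using this
    have e7 : d.dist x (g (h x)) = d.dist x (h x) := by
      have := hg x (h x)
      rwa [← hgx] at this
    rw [← hgx, dist_self, zero_add, ← e7]
    refine hX.hyperbolicLength_eq_of_between (hg.mul hh) ?_ c6
    apply ne_of_dist_pos (d := d)
    rw [Equiv.Perm.mul_apply, e7]
    exact dist_pos hh0
  · exact hX.hyperbolicLength_mul hg hh hgx hh0 c2 c3.symm

end Pairs

end LambdaMetric

namespace LambdaMetric

/-! ### The special point when two hyperbolic elements violate subadditivity -/

section Irreducible

variable {Λ : Type*} [AddCommGroup Λ] [LinearOrder Λ] [IsOrderedAddMonoid Λ] {X : Type*}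
  {d : LambdaMetric Λ X}

theorem IsTree.hyperbolicLength_mul_le (hX : d.IsTree) {a b : Equiv.Perm X} (ha : d.IsIsometric a)
    (hb : d.IsIsometric b) (x : X) :
    d.hyperbolicLength (a * b) ≤ d.dist x (a x) + d.dist x (b x) := by
  have h1 := hX.hyperbolicLength_le (ha.mul hb) x
  have h2 := d.triangle x (a x) (a (b x))
  have h3 := ha x (b x)
  simp only [Equiv.Perm.mul_apply] at h1
  grind

/-- If `x` lies strictly inside the bridge joining the characteristic sets of `a` and `b`, then
distances to `x` are determined by displacements. -/
theorem IsTree.two_dist_eq_max (hX : d.IsTree) {a b : Equiv.Perm X} (ha : d.IsIsometric a)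
    (hb : d.IsIsometric b) {x : X} (hax : d.hyperbolicLength a < d.dist x (a x))
    (hbx : d.hyperbolicLength b < d.dist x (b x)) (hab : d.Between (a x) x (b x)) (p : X) :
    d.dist p x + d.dist p x =
      max (d.dist p (a p) - d.dist x (a x)) (d.dist p (b p) - d.dist x (b x)) := by
  have key : ∀ c : Equiv.Perm X, d.IsIsometric c →
      d.dist p (c p) ≤ d.dist x (c x) + (d.dist p x + d.dist p x) := by
    intro c hc
    have h1 := d.triangle p x (c p)
    have h2 := d.triangle x (c x) (c p)
    have h3 := hc x p
    have h4 := d.symm x p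
    grind
  have h1 := key a ha
  have h2 := key b hb
  rcases hX.between_or hab p with h | h
  · have := (hX.dist_apply_of_between ha hax h.symm).2.2
    grind
  · have := (hX.dist_apply_of_between hb hbx h.symm).2.2
    grind

/-- All three terms are at most `d(x, m x)`. If the first is smaller, `m x` avoids the direction of
`a x` or of `b x`, so `x` lies on the axis of `a * m` or `b * m` and the corresponding term is
attained. -/
theorem IsTree.dist_eq_max_length (hX : d.IsTree) {a b : Equiv.Perm X} (ha : d.IsIsometric a)
    (hb : d.IsIsometric b) {x : X} (hax : d.hyperbolicLength a < d.dist x (a x))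
    (hbx : d.hyperbolicLength b < d.dist x (b x)) (hab : d.Between (a x) x (b x))
    {m : Equiv.Perm X} (hm : d.IsIsometric m) :
    d.dist x (m x) = max (d.hyperbolicLength m) (max (d.hyperbolicLength (a * m) - d.dist x (a x))
      (d.hyperbolicLength (b * m) - d.dist x (b x))) := by
  have : Nonempty X := ⟨x⟩
  have h1 := hX.hyperbolicLength_le hm x
  have h2 := hX.hyperbolicLength_mul_le ha hm x
  have h3 := hX.hyperbolicLength_mul_le hb hm x
  rcases h1.eq_or_lt with h | h
  · grind
  · have key : ∀ c : Equiv.Perm X, d.IsIsometric c → d.hyperbolicLength c < d.dist x (c x) →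
        d.Between (c x) x (m x) →
        d.hyperbolicLength (c * m) = d.dist x (c x) + d.dist x (m x) := by
      intro c hc hcx hcm
      have k1 := (hX.hyperbolicLength_nonneg hc).trans_lt hcx
      have k2 := (hX.hyperbolicLength_nonneg hm).trans_lt h
      apply hX.hyperbolicLength_mul hc hm (ne_of_dist_pos k1) (ne_of_dist_pos k2)
      · exact (hX.between_of_not hcm.symm (hX.not_between_inv hc hcx)).symm
      · exact (hX.between_of_not hcm (hX.not_between_inv hm h)).symm
    rcases hX.between_or hab (m x) with h' | h'
    · have := key a ha hax h'
      grind
    · have := key b hb hbx h'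
      grind

/-- Twice the displacement of a point inside the bridge joining the axes of `h` and `g h g⁻¹`,
expressed through the hyperbolic length function. -/
def bridgeDisplacement {N : Type*} [Group N] (ℓ : N → Λ) (g h k : N) : Λ :=
  -- For the special point `x`, `u` and `v` are its displacements under `h` and `g * h * g⁻¹`, and
  -- `E m` is its displacement under `m`.
  let u := ℓ (g * h) - ℓ g
  let v := ℓ (g * h) + ℓ g
  let E : N → Λ := fun m => max (ℓ m) (max (ℓ (h * m) - u) (ℓ (g * h * g⁻¹ * m) - v))
  max (E (k⁻¹ * h * k) - u) (E (k⁻¹ * (g * h * g⁻¹) * k) - v)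

theorem IsTree.exists_special_of_hyperbolic (hX : d.IsTree) [Nonempty X] {N : Type*} [Group N]
    {ρ : N →* Equiv.Perm X} (hiso : d.IsIsometricAction ρ) {g h : N}
    (hg : 0 < d.hyperbolicLength (ρ g)) (hh : 0 < d.hyperbolicLength (ρ h))
    (hlt : d.hyperbolicLength (ρ g) + d.hyperbolicLength (ρ h) < d.hyperbolicLength (ρ (g * h))) :
    ∃ x, (∀ k, d.dist x (ρ k x) + d.dist x (ρ k x) =
        bridgeDisplacement (fun n => d.hyperbolicLength (ρ n)) g h k) ∧
      ∀ p, (∀ n, d.dist p (ρ n p) = d.dist x (ρ n x)) → p = x := by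
  have hI : ∀ n, d.IsIsometric (ρ n) := hiso
  have hgh : d.hyperbolicLength (ρ (g * h)) = d.hyperbolicLength (ρ g * ρ h) := by rw [map_mul]
  obtain ⟨x, hgx, hhx, hx, b1, b2⟩ := hX.exists_bridge (hI g) (hI h)
    ((hX.hyperbolicLength_pos_iff (hI g)).1 hg).2 ((hX.hyperbolicLength_pos_iff (hI h)).1 hh).2
    (hgh ▸ hlt)
  rw [← hgh] at hx
  have hconj : ρ (g * h * g⁻¹) = ρ g * ρ h * (ρ g)⁻¹ := by simp
  have hgx0 : x ≠ ρ g x := ne_of_dist_pos (d := d) (hgx ▸ hg)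
  obtain ⟨c1, c2, c3⟩ := hX.dist_apply_of_between (hI h) hhx b2
  have D1 : d.dist x (ρ (g * h * g⁻¹) x) =
      d.hyperbolicLength (ρ (g * h)) + d.hyperbolicLength (ρ g) := by
    have e1 : d.dist x (ρ (g * h * g⁻¹) x) = d.dist ((ρ g)⁻¹ x) (ρ h ((ρ g)⁻¹ x)) := by
      rw [hconj, (hI g).dist_inv_left]
      rfl
    have e2 := (hI g).dist_inv_self x
    have e3 := d.symm x ((ρ g)⁻¹ x)
    grind
  have D2 : d.dist x (ρ h x) = d.hyperbolicLength (ρ (g * h)) - d.hyperbolicLength (ρ g) := by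
    grind
  have D3 : d.hyperbolicLength (ρ (g * h * g⁻¹)) = d.hyperbolicLength (ρ h) := by
    rw [hconj, hX.hyperbolicLength_conj (hI g) (hI h)]
  have hbx : d.hyperbolicLength (ρ (g * h * g⁻¹)) < d.dist x (ρ (g * h * g⁻¹) x) := by grind
  have c4 : d.Between x (ρ g x) (ρ (g * h * g⁻¹) x) := by
    rw [hconj]
    exact (hI g).between_inv_left.1 c1
  -- At `x` the axis of `h` lies along the bridge, that of `g * h * g⁻¹` in the direction of `g x`.
  have hab : d.Between (ρ h x) x (ρ (g * h * g⁻¹) x) :=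
    hX.between_of_not b1.symm (not_between_of_between c4 hgx0)
  refine ⟨x, fun k => ?_, fun p hp => ?_⟩
  · have e1 := hX.two_dist_eq_max (hI h) (hI (g * h * g⁻¹)) hhx hbx hab (ρ k x)
    have e2 : ∀ n, d.dist (ρ k x) (ρ n (ρ k x)) = d.dist x (ρ (k⁻¹ * n * k) x) := by
      intro n
      have := hI k x (ρ (k⁻¹ * n * k) x)
      simpa using this
    have e3 := fun m => hX.dist_eq_max_length (hI h) (hI (g * h * g⁻¹)) hhx hbx hab (hI m)
    rw [e2, e2, e3 (k⁻¹ * h * k), e3 (k⁻¹ * (g * h * g⁻¹) * k), ← map_mul, ← map_mul, ← map_mul,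
      ← map_mul, D1, D2, d.symm _ x] at e1
    exact e1
  · have e1 := hX.two_dist_eq_max (hI h) (hI (g * h * g⁻¹)) hhx hbx hab p
    rw [hp, hp, sub_self, sub_self, max_self] at e1
    rw [← d.eq_zero_iff]
    grind

end Irreducible

end LambdaMetric

namespace LambdaMetric

/-! ### The special point when lengths of hyperbolic elements are subadditive -/

section Dihedral

variable {Λ : Type*} [AddCommGroup Λ] [LinearOrder Λ] [IsOrderedAddMonoid Λ] {X : Type*}
  {d : LambdaMetric Λ X}

/-- Since `h` moves `x` away from the axis of `s`, the axes of `s` and `h s h⁻¹` are disjoint. This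
is the source of contradictions with subadditivity. -/
theorem IsTree.length_mul_conj_of_between (hX : d.IsTree) {s h : Equiv.Perm X}
    (hs : d.IsIsometric s) (hh : d.IsIsometric h) {x : X}
    (hsx : d.dist x (s x) = d.hyperbolicLength s) (hs0 : 0 < d.hyperbolicLength s)
    (hhx : d.hyperbolicLength h < d.dist x (h x)) (h1 : d.Between (s x) x (h x))
    (h2 : d.Between (s⁻¹ x) x (h x)) :
    d.hyperbolicLength s + d.hyperbolicLength s < d.hyperbolicLength (s * (h * s * h⁻¹)) := by
  have : Nonempty X := ⟨x⟩
  have hh0 : 0 < d.dist x (h x) := (hX.hyperbolicLength_nonneg hh).trans_lt hhx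
  have hne : x ≠ h x := ne_of_dist_pos (d := d) hh0
  have hse : x ≠ s x := ne_of_dist_pos (d := d) (hsx ▸ hs0)
  have hse' : x ≠ s⁻¹ x := ne_of_dist_pos (d := d) (by rw [hs.dist_inv_self, hsx]; exact hs0)
  have hni := hX.not_between_inv hh hhx
  have k1 : d.Between (h⁻¹ x) x (s x) := (hX.between_of_not h1 hni).symm
  have k2 : d.Between (h⁻¹ x) x (s⁻¹ x) := (hX.between_of_not h2 hni).symm
  obtain ⟨m1, -, m3⟩ := hX.between_of_between hs hse k1 k2
  obtain ⟨m4, -, -⟩ := hX.between_of_between hs.inv hse' k2 (by simpa using k1)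
  have n1 : d.Between x (h x) ((h * s * h⁻¹) x) := hh.between_inv_left.1 m1
  have n2 : d.Between x (h x) ((h * s * h⁻¹)⁻¹ x) := by
    have := hh.between_inv_left.1 m4
    simpa [mul_assoc] using this
  have hb : d.IsIsometric (h * s * h⁻¹) := (hh.mul hs).mul hh.inv
  have e1 : d.dist x ((h * s * h⁻¹) x) = d.dist (h⁻¹ x) (s (h⁻¹ x)) := by
    rw [hh.dist_inv_left]
    rfl
  have e2 := hh.dist_inv_self x
  have e3 := d.symm x (h⁻¹ x)
  rw [hX.hyperbolicLength_mul hs hb hse]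
  · grind
  · apply ne_of_dist_pos (d := d)
    grind
  · exact hX.between_of_not h2 (not_between_of_between n1 hne)
  · exact (hX.between_of_not h1 (not_between_of_between n2 hne)).symm

section Action

variable {N : Type*} [Group N] {ρ : N →* Equiv.Perm X}

/-- The length function is subadditive on pairs of hyperbolic elements. -/
def SubadditiveOnPos {N : Type*} [Group N] (ℓ : N → Λ) : Prop :=
  ∀ s t, 0 < ℓ s → 0 < ℓ t → ℓ (s * t) ≤ ℓ s + ℓ t

theorem IsTree.hyperbolicLength_eq_zero_of_subadditive (hX : d.IsTree) [Nonempty X]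
    (hiso : d.IsIsometricAction ρ) (hinv : ∀ n, ¬ IsInversion (ρ n))
    (hdih : SubadditiveOnPos fun n => d.hyperbolicLength (ρ n)) {g h : N}
    (hlt : d.hyperbolicLength (ρ g) + d.hyperbolicLength (ρ h) < d.hyperbolicLength (ρ (g * h))) :
    d.hyperbolicLength (ρ g) = 0 := by
  have hI : ∀ n, d.IsIsometric (ρ n) := hiso
  by_contra hne
  have hg : 0 < d.hyperbolicLength (ρ g) :=
    lt_of_le_of_ne (hX.hyperbolicLength_nonneg (hI g)) (Ne.symm hne)
  rw [map_mul] at hlt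
  obtain ⟨x, hgx, hhx, hx, b1, b2⟩ := hX.exists_bridge (hI g) (hI h) (hinv g) (hinv h) hlt
  have h1 := hX.length_mul_conj_of_between (hI g) (hI h) hgx hg hhx b1 b2
  have h2 : d.hyperbolicLength (ρ (h * g * h⁻¹)) = d.hyperbolicLength (ρ g) := by
    rw [map_mul, map_mul, map_inv, hX.hyperbolicLength_conj (hI h) (hI g)]
  have h3 := hdih g (h * g * h⁻¹) hg (by simpa only [h2] using hg)
  simp only [h2] at h3
  simp only [map_mul, map_inv] at h3 h1
  grind

/-- In a dihedral action without inversions, let `x` be the endpoint of the bridge joining the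
fixed point sets of `g` and `h`. Then the axis of every hyperbolic element contains `x`. -/
theorem IsTree.dist_eq_length_of_subadditive (hX : d.IsTree) (hiso : d.IsIsometricAction ρ)
    (hdih : SubadditiveOnPos fun n => d.hyperbolicLength (ρ n)) {g h : N} {x : X}
    (hgx : ρ g x = x) (hhx : d.hyperbolicLength (ρ h) < d.dist x (ρ h x))
    (hb : d.Between (ρ h x) x (ρ g (ρ h x))) (ht : 0 < d.hyperbolicLength (ρ (g * h))) {s : N}
    (hs : 0 < d.hyperbolicLength (ρ s)) : d.dist x (ρ s x) = d.hyperbolicLength (ρ s) := by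
  have hI : ∀ n, d.IsIsometric (ρ n) := hiso
  have : Nonempty X := ⟨x⟩
  have hgi : (ρ g)⁻¹ x = x := by rw [Equiv.Perm.inv_eq_iff_eq, hgx]
  by_contra hne
  have hlt : d.hyperbolicLength (ρ s) < d.dist x (ρ s x) :=
    lt_of_le_of_ne (hX.hyperbolicLength_le (hI s) x) (Ne.symm hne)
  have hsx : x ≠ ρ s x := ne_of_dist_pos (d := d) (hs.trans hlt)
  have hni := hX.not_between_inv (hI s) hlt
  have hnh := hX.not_between_inv (hI h) hhx
  have hgb : ∀ {y z : X}, d.Between (ρ g y) x (ρ g z) ↔ d.Between y x z := by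
    intro y z
    have := (hI g).between_iff (x := y) (v := x) (y := z)
    rwa [hgx] at this
  -- Otherwise `s` and its conjugate by `g` have axes on different sides of `x`, and their product
  -- has length `2 d(x, s x)`, which is too large.
  have hngs : ¬ d.Between (ρ s x) x (ρ g (ρ s x)) := by
    intro hb'
    have e1 : ∀ y, ρ (g * s * g⁻¹) y = ρ g (ρ s ((ρ g)⁻¹ y)) := by intro y; simp
    have e2 : ρ (g * s * g⁻¹) x = ρ g (ρ s x) := by rw [e1, hgi]
    have e3 : (ρ (g * s * g⁻¹))⁻¹ x = ρ g ((ρ s)⁻¹ x) := by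
      rw [Equiv.Perm.inv_eq_iff_eq, e1]
      simp [hgx]
    have e4 : d.dist x (ρ g (ρ s x)) = d.dist x (ρ s x) := by
      have := hI g x (ρ s x)
      rwa [hgx] at this
    have e5 : d.hyperbolicLength (ρ (g * s * g⁻¹)) = d.hyperbolicLength (ρ s) := by
      rw [map_mul, map_mul, map_inv, hX.hyperbolicLength_conj (hI g) (hI s)]
    have e6 := hdih s (g * s * g⁻¹) hs (by simpa only [e5] using hs)
    simp only [e5] at e6
    rw [map_mul, hX.hyperbolicLength_mul (hI s) (hI _) hsx, e2, e4] at e6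
    · grind
    · rw [e2]
      apply ne_of_dist_pos (d := d)
      rw [e4]
      exact hs.trans hlt
    · rw [e2]
      exact (hX.between_of_not hb'.symm hni).symm
    · rw [e3]
      exact (hX.between_of_not hb' (mt hgb.1 hni)).symm
  have k1 : d.Between (ρ s x) x (ρ h x) := by
    by_contra hc
    have k2 := hX.between_of_not hb.symm (mt Between.symm hc)
    have k3 := hX.between_of_not k2.symm (mt hgb.1 (mt Between.symm hc))
    exact hngs k3
  have k2 : d.Between (ρ s x) x (ρ g (ρ h x)) := by
    by_contra hc
    exact hngs (hX.between_of_not (hgb.2 k1) (mt Between.symm hc)).symm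
  have t1 : ρ (g * h) x = ρ g (ρ h x) := by simp
  have t2 : (ρ (g * h))⁻¹ x = (ρ h)⁻¹ x := by
    rw [map_mul, mul_inv_rev, Equiv.Perm.mul_apply, hgi]
  have e1 := hdih s (g * h) hs ht
  have e2 := hX.hyperbolicLength_le (hI (g * h)) x
  simp only [map_mul ρ s] at e1
  rw [hX.hyperbolicLength_mul (hI s) (hI _) hsx] at e1
  · grind
  · exact ne_of_dist_pos (d := d) (ht.trans_le e2)
  · rw [t1]
    exact (hX.between_of_not k2.symm hni).symm
  · rw [t2]
    exact (hX.between_of_not k1 hnh).symm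

/-- In the same situation, `g` sends points on axes to the other side of `x`. -/
theorem IsTree.between_apply_of_subadditive (hX : d.IsTree) (hiso : d.IsIsometricAction ρ)
    (hdih : SubadditiveOnPos fun n => d.hyperbolicLength (ρ n)) {g h : N} {x : X}
    (hgx : ρ g x = x) (hhx : d.hyperbolicLength (ρ h) < d.dist x (ρ h x))
    (hb : d.Between (ρ h x) x (ρ g (ρ h x))) (ht : 0 < d.hyperbolicLength (ρ (g * h))) {s : N}
    (hs : 0 < d.hyperbolicLength (ρ s)) {y : X}
    (hy : d.dist y (ρ s y) ≤ d.hyperbolicLength (ρ s)) : d.Between y x (ρ g y) := by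
  have hI : ∀ n, d.IsIsometric (ρ n) := hiso
  have : Nonempty X := ⟨x⟩
  have hgb : ∀ {y z : X}, d.Between (ρ g y) x (ρ g z) ↔ d.Between y x z := by
    intro y z
    have := (hI g).between_iff (x := y) (v := x) (y := z)
    rwa [hgx] at this
  by_contra hng
  have hyx : y ≠ x := by
    rintro rfl
    exact hng (between_left _ _)
  have k1 : d.Between y x (ρ h x) := by
    by_contra hc
    have k2 := hX.between_of_not hb.symm (mt Between.symm hc)
    exact hng (hX.between_of_not k2.symm (mt hgb.1 (mt Between.symm hc)))
  have k2 : d.Between y x (ρ g (ρ h x)) := by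
    by_contra hc
    exact hng (hX.between_of_not (hgb.2 k1) (mt Between.symm hc)).symm
  have axis : ∀ s : N, 0 < d.hyperbolicLength (ρ s) →
      d.dist x (ρ s x) = d.hyperbolicLength (ρ s) := fun s hs =>
    hX.dist_eq_length_of_subadditive hiso hdih hgx hhx hb ht hs
  -- Every axis through `x` must use the direction of `h x`; conjugating by `g`, also that of `gh
  -- x`. As `y` avoids both, it is not on the axis of `s`.
  have step : ∀ s : N, 0 < d.hyperbolicLength (ρ s) → d.Between (ρ s x) x (ρ h x) →
      d.Between ((ρ s)⁻¹ x) x (ρ h x) → False := by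
    intro s hs h1 h2
    have e1 := hX.length_mul_conj_of_between (hI s) (hI h) (axis s hs) hs hhx h1 h2
    have e2 : d.hyperbolicLength (ρ (h * s * h⁻¹)) = d.hyperbolicLength (ρ s) := by
      rw [map_mul, map_mul, map_inv, hX.hyperbolicLength_conj (hI h) (hI s)]
    have e3 := hdih s (h * s * h⁻¹) hs (by simpa only [e2] using hs)
    simp only [e2] at e3
    simp only [map_mul, map_inv] at e1 e3
    grind
  have step' : ∀ s : N, 0 < d.hyperbolicLength (ρ s) → d.Between (ρ s x) x (ρ g (ρ h x)) →
      d.Between ((ρ s)⁻¹ x) x (ρ g (ρ h x)) → False := by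
    intro s hs h1 h2
    have hgi : (ρ g)⁻¹ x = x := by rw [Equiv.Perm.inv_eq_iff_eq, hgx]
    refine step (g⁻¹ * s * g) ?_ ?_ ?_
    · have := hX.hyperbolicLength_conj (hI g).inv (hI s)
      rw [inv_inv] at this
      rwa [map_mul, map_mul, map_inv, this]
    · rw [← hgb]
      simpa [hgx] using h1
    · rw [← hgb]
      simpa [hgx, mul_assoc] using h2
  have final : ∀ s : N, 0 < d.hyperbolicLength (ρ s) → ¬ d.Between y x (ρ s x) → False := by
    intro s hs hys
    have h1 : d.Between (ρ s x) x (ρ h x) := (hX.between_of_not k1.symm hys).symm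
    have h2 : d.Between (ρ s x) x (ρ g (ρ h x)) := (hX.between_of_not k2.symm hys).symm
    have h3 : ¬ d.Between ((ρ s)⁻¹ x) x (ρ h x) := fun h => step s hs h1 h
    have h4 : ¬ d.Between ((ρ s)⁻¹ x) x (ρ g (ρ h x)) := fun h => step' s hs h2 h
    have h5 := hX.between_of_not hb (mt Between.symm h4)
    exact h3 h5.symm
  by_cases h1 : d.Between y x (ρ s x)
  · by_cases h2 : d.Between y x ((ρ s)⁻¹ x)
    · have hsx : x ≠ ρ s x := ne_of_dist_pos (d := d) (axis s hs ▸ hs)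
      have e1 := (hX.between_of_between (hI s) hsx h1 h2).2.2
      have e2 := dist_pos (d := d) hyx
      have e3 := axis s hs
      grind
    · apply final s⁻¹
      · rwa [map_inv, hX.hyperbolicLength_inv (hI s)]
      · rwa [map_inv]
  · exact final s hs h1

/-- `k x` lies on the axis of a conjugate of `gh`. There `g` and `k g k⁻¹` act like reflections in
`x` and `k x`, so their product translates by twice the distance. -/
theorem IsTree.exists_special_of_subadditive (hX : d.IsTree) [Nonempty X]
    (hiso : d.IsIsometricAction ρ) (hinv : ∀ n, ¬ IsInversion (ρ n))
    (hdih : SubadditiveOnPos fun n => d.hyperbolicLength (ρ n)) {g h : N}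
    (hlt : d.hyperbolicLength (ρ g) + d.hyperbolicLength (ρ h) < d.hyperbolicLength (ρ (g * h))) :
    ∃ x, (∀ k, d.dist x (ρ k x) + d.dist x (ρ k x) =
        d.hyperbolicLength (ρ (g * (k * g * k⁻¹)))) ∧
      ∀ p, (∀ n, d.dist p (ρ n p) = d.dist x (ρ n x)) → p = x := by
  have hI : ∀ n, d.IsIsometric (ρ n) := hiso
  have hg0 := hX.hyperbolicLength_eq_zero_of_subadditive hiso hinv hdih hlt
  have hh0 := hX.hyperbolicLength_nonneg (hI h)
  have ht : 0 < d.hyperbolicLength (ρ (g * h)) := by grind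
  rw [map_mul] at hlt
  obtain ⟨x, hgx, hhx, hx, b1, b2⟩ := hX.exists_bridge (hI g) (hI h) (hinv g) (hinv h) hlt
  rw [hg0, d.eq_zero_iff] at hgx
  replace hgx := hgx.symm
  have hgi : (ρ g)⁻¹ x = x := by rw [Equiv.Perm.inv_eq_iff_eq, hgx]
  have hgb : ∀ {y z : X}, d.Between (ρ g y) x (ρ g z) ↔ d.Between y x z := by
    intro y z
    have := (hI g).between_iff (x := y) (v := x) (y := z)
    rwa [hgx] at this
  have hdx : d.dist x (ρ g (ρ h x)) = d.dist x (ρ h x) := by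
    have := hI g x (ρ h x)
    rwa [hgx] at this
  have hDt : d.dist x (ρ (g * h) x) = d.hyperbolicLength (ρ (g * h)) := by
    rw [hgx, dist_self, zero_add] at hx
    rw [map_mul, hx, Equiv.Perm.mul_apply, hdx]
  have hb : d.Between (ρ h x) x (ρ g (ρ h x)) := by
    have h1 := hX.between_inv_of_eq (hI (g * h)) hDt ht
    have h2 : (ρ (g * h))⁻¹ x = (ρ h)⁻¹ x := by
      rw [map_mul, mul_inv_rev, Equiv.Perm.mul_apply, hgi]
    rw [h2, map_mul, Equiv.Perm.mul_apply] at h1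
    exact (hX.between_of_not h1 (mt Between.symm (hX.not_between_inv (hI h) hhx))).symm
  refine ⟨x, fun k => ?_, fun p hp => ?_⟩
  · have orbit : ∀ k, d.Between (ρ k x) x (ρ g (ρ k x)) := by
      intro k
      have h1 : d.hyperbolicLength (ρ (k * (g * h) * k⁻¹)) = d.hyperbolicLength (ρ (g * h)) := by
        rw [map_mul, map_mul, map_inv, hX.hyperbolicLength_conj (hI k) (hI _)]
      refine hX.between_apply_of_subadditive hiso hdih hgx hhx hb ht (s := k * (g * h) * k⁻¹)
        (h1 ▸ ht) ?_
      rw [h1, ← hDt]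
      have := hI k x (ρ (g * h) x)
      simpa using this.le
    by_cases hkx : x = ρ k x
    · have hki : (ρ k)⁻¹ x = x := by rw [Equiv.Perm.inv_eq_iff_eq, ← hkx]
      rw [← hkx, dist_self, add_zero, hyperbolicLength_eq_zero_of_apply_eq (x := x)]
      simp only [map_mul, map_inv, Equiv.Perm.mul_apply]
      rw [hki, hgx, ← hkx, hgx]
    · have k1 := orbit k
      have k2 := orbit k⁻¹
      rw [map_inv, (hI k).between_inv_left] at k2
      have k3 : d.Between x (ρ k x) (ρ k ((ρ g)⁻¹ ((ρ k)⁻¹ x))) := by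
        have h1 := orbit k⁻¹
        have h2 : ρ g ((ρ g)⁻¹ ((ρ k)⁻¹ x)) = (ρ k)⁻¹ x := by simp
        rw [map_inv] at h1
        nth_rw 1 [← h2] at h1
        rw [hgb] at h1
        exact (hI k).between_inv_left.1 h1.symm
      have n2 := not_between_of_between k2 hkx
      have n3 := not_between_of_between k3 hkx
      have k4 := hX.between_of_not k1 (mt hgb.1 n2)
      have k5 := (hX.between_of_not k4.symm n3).symm
      have hc := hI (g * (k * g * k⁻¹))
      have c1 : ρ (g * (k * g * k⁻¹)) x = ρ g (ρ k (ρ g ((ρ k)⁻¹ x))) := by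
        simp only [map_mul, map_inv, Equiv.Perm.mul_apply]
      have c2 : (ρ (g * (k * g * k⁻¹)))⁻¹ x = ρ k ((ρ g)⁻¹ ((ρ k)⁻¹ x)) := by
        simp only [map_mul, map_inv, mul_inv_rev, inv_inv, Equiv.Perm.mul_apply, hgi]
      have e1 : d.dist x (ρ (g * (k * g * k⁻¹)) x) = d.dist x (ρ k x) + d.dist x (ρ k x) := by
        have h1 := hI g x (ρ k (ρ g ((ρ k)⁻¹ x)))
        have h2 := hI k x (ρ g ((ρ k)⁻¹ x))
        have h3 := hI g x ((ρ k)⁻¹ x)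
        have h4 := (hI k).dist_inv_self x
        rw [hgx] at h1 h3
        rw [c1, h1, ← k2, h2, h3, h4]
      rw [← c1, ← c2, hc.between_inv_left] at k5
      rw [← e1, hX.hyperbolicLength_eq_of_between hc _ k5]
      apply ne_of_dist_pos (d := d)
      have := dist_pos (d := d) hkx
      grind
  · by_contra hpx
    -- Having the displacements of `x`, `p` is on the axis of `gh`, hence flipped by `g`, and also
    -- fixed by `g`.
    have h1 := hX.between_apply_of_subadditive hiso hdih hgx hhx hb ht ht (y := p)
      (by rw [hp, hDt])
    have h2 : ρ g p = p := by
      have := hp g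
      rw [hgx, dist_self, d.eq_zero_iff] at this
      exact this.symm
    rw [h2] at h1
    have h3 := dist_pos (d := d) hpx
    have h4 := dist_pos (d := d) (Ne.symm hpx)
    have h5 := dist_self (d := d) p
    unfold Between at h1
    grind

end Action

end Dihedral

end LambdaMetric

namespace LambdaMetric

/-! ### Rigidity of minimal actions and reconstruction from an orbit -/

section Uniqueness

variable {Λ : Type*} [AddCommGroup Λ] [LinearOrder Λ] [IsOrderedAddMonoid Λ] {X : Type*}
  {d : LambdaMetric Λ X} {N : Type*} [Group N] {ρ : N →* Equiv.Perm X}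

omit [IsOrderedAddMonoid Λ] in
theorem nonempty_of_not_isAbelianAction (h : ¬ d.IsAbelianAction ρ) : Nonempty X := by
  by_contra hX
  rw [not_nonempty_iff] at hX
  apply h
  have key : ∀ c : Equiv.Perm X, d.hyperbolicLength c = 0 := by
    intro c
    unfold hyperbolicLength
    simp [IsInversion, IsLeast]
  intro g h
  simp [key]

/-- A minimal non-abelian action, free of inversions if dihedral, has a point that is determined
by its displacements, and these depend only on the hyperbolic length function. -/
theorem exists_displacement_of_length [Nonempty X] {ℓ : N → Λ}
    (hℓ : ∃ g h, ℓ g + ℓ h < ℓ (g * h)) :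
    ∃ F : N → Λ, ∀ (d : LambdaMetric Λ X) (ρ : N →* Equiv.Perm X), d.IsTree →
      d.IsIsometricAction ρ → (d.IsDihedralAction ρ → ∀ n, ¬ IsInversion (ρ n)) →
      (fun n => d.hyperbolicLength (ρ n)) = ℓ →
      ∃ x, (∀ k, d.dist x (ρ k x) + d.dist x (ρ k x) = F k) ∧
        ∀ p, (∀ n, d.dist p (ρ n p) = d.dist x (ρ n x)) → p = x := by
  -- The case and the choice of `g`, `h` depend on `ℓ` only, so one `F` serves all actions with this
  -- length function.
  by_cases hs : SubadditiveOnPos ℓ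
  · obtain ⟨g, h, hlt⟩ := hℓ
    refine ⟨fun k => ℓ (g * (k * g * k⁻¹)), ?_⟩
    rintro d ρ hX hiso hdih rfl
    refine hX.exists_special_of_subadditive hiso (hdih ⟨?_, ?_⟩) hs hlt
    · exact fun hab => (hab g h).not_gt hlt
    · intro s t hs' ht'
      exact hs s t ((hX.hyperbolicLength_pos_iff (hiso s)).2 hs')
        ((hX.hyperbolicLength_pos_iff (hiso t)).2 ht')
  · unfold SubadditiveOnPos at hs
    push Not at hs
    obtain ⟨g, h, hg, hh, hlt⟩ := hs
    refine ⟨bridgeDisplacement ℓ g h, ?_⟩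
    rintro d ρ hX hiso - rfl
    exact hX.exists_special_of_hyperbolic hiso hg hh hlt

/-- Isometries commuting with the action are trivial. -/
theorem eq_one_of_commute (hX : d.IsTree) (hiso : d.IsIsometricAction ρ)
    (hmin : d.IsMinimalAction ρ) (hnonab : ¬ d.IsAbelianAction ρ)
    (hdih : d.IsDihedralAction ρ → ∀ n, ¬ IsInversion (ρ n)) {ψ : Equiv.Perm X}
    (hψ : d.IsIsometric ψ) (hcomm : ∀ n x, ψ (ρ n x) = ρ n (ψ x)) (x : X) : ψ x = x := by
  have : Nonempty X := ⟨x⟩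
  have hℓ : ∃ g h, d.hyperbolicLength (ρ g) + d.hyperbolicLength (ρ h) <
      d.hyperbolicLength (ρ (g * h)) := by
    unfold IsAbelianAction at hnonab
    push Not at hnonab
    exact hnonab
  obtain ⟨F, hF⟩ := exists_displacement_of_length (X := X)
    (ℓ := fun n => d.hyperbolicLength (ρ n)) hℓ
  obtain ⟨y, -, hy⟩ := hF d ρ hX hiso hdih rfl
  have hyfix : ψ y = y := by
    apply hy
    intro n
    rw [← hcomm, hψ]
  have huniv := hmin {z | ψ z = z} ⟨y, hyfix⟩ ?_ ?_
  · exact huniv.ge (Set.mem_univ x)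
  · intro a ha b hb z hz
    have hz' : d.Between a z b := hz
    have hz'' : d.Between a (ψ z) b := by
      have := hψ.between_iff.2 hz'
      rwa [ha, hb] at this
    apply hX.eq_of_dist_eq hz'' hz'
    · have := hψ a z
      rwa [ha] at this
    · have := d.symm a b
      have h1 := dist_self (d := d) b
      have h2 := hψ a z
      have h3 := d.nonneg z b
      rw [ha] at h2
      unfold twiceGromov
      unfold Between at hz'
      grind
  · intro g z hz
    have hz : ψ z = z := hz
    change ψ (ρ g z) = ρ g z
    rw [hcomm, hz]

/-- At `v`, one of `a`, `b` lies on the side of `z` and one of `c`, `e` on the side of `w`. Hence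
the union of all segments between points of a set is already a subtree. -/
theorem IsTree.exists_between_of_between (hX : d.IsTree) {a b c e z w v : X}
    (hz : d.Between a z b) (hw : d.Between c w e) (hv : d.Between z v w) :
    d.Between a v b ∨ d.Between c v e ∨ d.Between a v c ∨ d.Between a v e ∨ d.Between b v c ∨
      d.Between b v e := by
  by_contra hcon
  push Not at hcon
  obtain ⟨h1, h2, h3, h4, h5, h6⟩ := hcon
  have hvz : v ≠ z := by
    rintro rfl
    exact h1 hz
  have hvw : v ≠ w := by
    rintro rfl
    exact h2 hw
  have key : ∀ {y p : X}, v ≠ y → d.Between y v p → d.Between p y v → False := by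
    intro y p hy k1 k2
    exact not_between_of_between k2.symm hy k1
  rcases hX.between_or hz v with k1 | k1 <;> rcases hX.between_or hw v with k2 | k2
  · have m1 := hX.between_of_not hv.symm (fun h => key hvz h k1)
    exact h3 (hX.between_of_not m1.symm (fun h => key hvw h k2))
  · have m1 := hX.between_of_not hv.symm (fun h => key hvz h k1)
    exact h4 (hX.between_of_not m1.symm (fun h => key hvw h k2))
  · have m1 := hX.between_of_not hv.symm (fun h => key hvz h k1)
    exact h5 (hX.between_of_not m1.symm (fun h => key hvw h k2))
  · have m1 := hX.between_of_not hv.symm (fun h => key hvz h k1)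
    exact h6 (hX.between_of_not m1.symm (fun h => key hvw h k2))

/-- In a minimal action, segments joining points of an orbit cover the tree. -/
theorem IsTree.exists_between_orbit (hX : d.IsTree) (hiso : d.IsIsometricAction ρ)
    (hmin : d.IsMinimalAction ρ) (x z : X) : ∃ m n, d.Between (ρ m x) z (ρ n x) := by
  have huniv := hmin {z | ∃ m n, d.Between (ρ m x) z (ρ n x)} ⟨x, 1, 1, ?_⟩ ?_ ?_
  · exact huniv.ge (Set.mem_univ z)
  · simpa using between_left x x
  · rintro z ⟨a, b, hz⟩ w ⟨c, e, hw⟩ v hv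
    rcases hX.exists_between_of_between hz hw hv with h | h | h | h | h | h
    exacts [⟨_, _, h⟩, ⟨_, _, h⟩, ⟨_, _, h⟩, ⟨_, _, h⟩, ⟨_, _, h⟩, ⟨_, _, h⟩]
  · rintro g z ⟨m, n, h⟩
    refine ⟨g * m, g * n, ?_⟩
    rw [map_mul, map_mul]
    exact IsIsometric.between_iff (hiso g) |>.2 h

section Extension

variable {X' : Type*} {d' : LambdaMetric Λ X'} {ρ' : N →* Equiv.Perm X'}

/-- Copy the position of `p` on a segment `[f i, f j]`; by `dist_eq_max` the remaining distances
follow from those to `f i` and `f j`. -/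
theorem IsTree.exists_dist_eq (hX : d.IsTree) (hX' : d'.IsTree) {ι : Type*} {f : ι → X}
    {f' : ι → X'} (hff : ∀ i j, d.dist (f i) (f j) = d'.dist (f' i) (f' j))
    (hf : ∀ p, ∃ i j, d.Between (f i) p (f j)) (p : X) :
    ∃ p', ∀ i, d.dist p (f i) = d'.dist p' (f' i) := by
  obtain ⟨i, j, hp⟩ := hf p
  have h1 := d.nonneg p (f j)
  obtain ⟨p', hp', hd⟩ := hX'.exists_between (x := f' i) (y := f' j) (d.nonneg (f i) p)
    (by rw [← hff, ← hp]; grind)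
  refine ⟨p', fun k => ?_⟩
  rw [hX.dist_eq_max hp, hX'.dist_eq_max hp', hff, hff, hd]
  have h2 := hff i j
  have h3 := d.symm p (f j)
  have h4 := d'.symm p' (f' j)
  unfold Between at hp hp'
  congr 2
  grind

theorem IsTree.dist_eq_of_dist_eq (hX : d.IsTree) (hX' : d'.IsTree) {ι : Type*} {f : ι → X}
    {f' : ι → X'} (hff : ∀ i j, d.dist (f i) (f j) = d'.dist (f' i) (f' j))
    (hf : ∀ p, ∃ i j, d.Between (f i) p (f j)) {p q : X} {p' q' : X'}
    (hp : ∀ i, d.dist p (f i) = d'.dist p' (f' i))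
    (hq : ∀ i, d.dist q (f i) = d'.dist q' (f' i)) : d.dist p q = d'.dist p' q' := by
  obtain ⟨i, j, hb⟩ := hf p
  have hb' : d'.Between (f' i) p' (f' j) := by
    unfold Between at *
    rw [← hff, ← hb, d.symm (f i), d'.symm (f' i), hp, hp]
  rw [hX.dist_eq_max hb, hX'.dist_eq_max hb', d.symm _ q, d.symm _ q, d.symm _ p, d.symm _ p, hp,
    hp, hq, hq, d'.symm _ q', d'.symm _ q', d'.symm _ p', d'.symm _ p']

/-- Points are encoded by their distances to the orbit. This encoding is faithful, which yields the
inverse and equivariance. -/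
theorem IsTree.exists_equivariant_isometry (hX : d.IsTree) (hX' : d'.IsTree)
    (hiso : d.IsIsometricAction ρ) (hiso' : d'.IsIsometricAction ρ') (hmin : d.IsMinimalAction ρ)
    (hmin' : d'.IsMinimalAction ρ') {x : X} {x' : X'}
    (hx : ∀ n, d.dist x (ρ n x) = d'.dist x' (ρ' n x')) :
    ∃ φ : X ≃ X', (∀ p q, d'.dist (φ p) (φ q) = d.dist p q) ∧
      ∀ n p, φ (ρ n p) = ρ' n (φ p) := by
  have hff : ∀ m n, d.dist (ρ m x) (ρ n x) = d'.dist (ρ' m x') (ρ' n x') := by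
    intro m n
    have h1 := hiso m x (ρ (m⁻¹ * n) x)
    have h2 := hiso' m x' (ρ' (m⁻¹ * n) x')
    rw [← Equiv.Perm.mul_apply, ← map_mul, mul_inv_cancel_left] at h1 h2
    rw [h1, h2, hx]
  have hf := hX.exists_between_orbit hiso hmin x
  have hf' := hX'.exists_between_orbit hiso' hmin' x'
  have hff' := fun m n => (hff m n).symm
  choose φ hφ using hX.exists_dist_eq hX' hff hf
  choose θ hθ using hX'.exists_dist_eq hX hff' hf'
  have hinj : ∀ {p : X} {p' : X'}, (∀ n, d.dist p (ρ n x) = d'.dist p' (ρ' n x')) → φ p = p' := by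
    intro p p' h
    rw [← d'.eq_zero_iff, ← hX.dist_eq_of_dist_eq hX' hff hf (hφ p) h, dist_self]
  have hinj' : ∀ {p : X} {p' : X'}, (∀ n, d.dist p (ρ n x) = d'.dist p' (ρ' n x')) →
      θ p' = p := by
    intro p p' h
    rw [← d.eq_zero_iff,
      ← hX'.dist_eq_of_dist_eq hX hff' hf' (hθ p') fun n => (h n).symm, dist_self]
  refine ⟨⟨φ, θ, fun p => hinj' (hφ p), fun p' => hinj fun n => (hθ p' n).symm⟩, ?_, ?_⟩
  · intro p q
    exact (hX.dist_eq_of_dist_eq hX' hff hf (hφ p) (hφ q)).symm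
  · intro n p
    refine hinj fun m => ?_
    have h1 := hiso n p (ρ (n⁻¹ * m) x)
    have h2 := hiso' n (φ p) (ρ' (n⁻¹ * m) x')
    rw [← Equiv.Perm.mul_apply, ← map_mul, mul_inv_cancel_left] at h1 h2
    exact h1.trans ((hφ p _).trans h2.symm)

end Extension

end Uniqueness

/-! ### Rescaling the metric by an automorphism of `Λ` -/

section Rescaling

variable {Λ : Type*} [AddCommGroup Λ] [LinearOrder Λ] {X : Type*}

/-- The metric `d` rescaled by an automorphism of `Λ`. -/
def rescale (d : LambdaMetric Λ X) (a : Λ ≃+o Λ) : LambdaMetric Λ X where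
  dist x y := a (d.dist x y)
  nonneg x y := by
    have h := (OrderIsoClass.map_le_map_iff a).2 (d.nonneg x y)
    rwa [map_zero] at h
  eq_zero_iff x y := by rw [EmbeddingLike.map_eq_zero_iff, d.eq_zero_iff]
  symm x y := by rw [d.symm]
  triangle x y z := by
    rw [← map_add]
    exact (OrderIsoClass.map_le_map_iff a).2 (d.triangle x y z)

variable {d : LambdaMetric Λ X} {a : Λ ≃+o Λ}

theorem twiceGromov_rescale (v x y : X) :
    (d.rescale a).twiceGromov v x y = a (d.twiceGromov v x y) := by
  simp [twiceGromov, rescale]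

theorem between_rescale {x v y : X} : (d.rescale a).Between x v y ↔ d.Between x v y := by
  simp only [Between, rescale]
  rw [← map_add, EmbeddingLike.apply_eq_iff_eq]

theorem map_max_aut (s t : Λ) : a (max s t) = max (a s) (a t) :=
  (OrderHomClass.mono a).map_max

theorem IsTree.rescale [IsOrderedAddMonoid Λ] (hX : d.IsTree) : (d.rescale a).IsTree where
  geodesic x y := by
    obtain ⟨f, h0, h1, h2⟩ := hX.geodesic x y
    have hmem : ∀ s ∈ Set.Icc 0 ((d.rescale a).dist x y),
        a.symm s ∈ Set.Icc 0 (d.dist x y) := by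
      intro s hs
      constructor
      · have := (OrderIsoClass.map_le_map_iff a.symm).2 hs.1
        rwa [map_zero] at this
      · have := (OrderIsoClass.map_le_map_iff a.symm).2 hs.2
        have h := a.symm_apply_apply (d.dist x y)
        exact this.trans h.le
    refine ⟨fun t => f (a.symm t), by simpa using h0, ?_, ?_⟩
    · change f (a.symm (a (d.dist x y))) = y
      rw [a.symm_apply_apply, h1]
    · intro s hs t ht
      change a (d.dist _ _) = _
      rw [h2 _ (hmem s hs) _ (hmem t ht), ← map_sub, abs_eq_max_neg, map_max_aut, map_neg,
        a.apply_symm_apply, abs_eq_max_neg]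
  gromov_mem v x y := by
    obtain ⟨c, hc⟩ := hX.gromov_mem v x y
    exact ⟨a c, by rw [← map_add, hc, twiceGromov_rescale]⟩
  hyperbolic v x y z := by
    rw [twiceGromov_rescale, twiceGromov_rescale, twiceGromov_rescale,
      ← (OrderHomClass.mono a).map_min]
    exact (OrderIsoClass.map_le_map_iff a).2 (hX.hyperbolic v x y z)

theorem IsTree.hyperbolicLength_rescale [IsOrderedAddMonoid Λ] [Nonempty X] (hX : d.IsTree)
    {c : Equiv.Perm X} (hc : d.IsIsometric c) :
    (d.rescale a).hyperbolicLength c = a (d.hyperbolicLength c) := by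
  have hc' : (d.rescale a).IsIsometric c := fun x y => congrArg a (hc x y)
  rw [hX.rescale.hyperbolicLength_eq hc' (Classical.arbitrary X),
    hX.hyperbolicLength_eq hc (Classical.arbitrary X), map_max_aut, map_sub, map_zero]
  rfl

theorem IsMinimalAction.rescale {N : Type*} [Group N] {ρ : N →* Equiv.Perm X}
    (hmin : d.IsMinimalAction ρ) : (d.rescale a).IsMinimalAction ρ := by
  intro S hne hS hinv
  refine hmin S hne (fun x hx y hy z hz => hS x hx y hy ?_) hinv
  exact between_rescale.2 hz

end Rescaling

end LambdaMetric

/-! ### Construction of the affine action -/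

namespace LambdaMetric

variable {Λ : Type*} [AddCommGroup Λ] [LinearOrder Λ] [IsOrderedAddMonoid Λ] {X : Type*}
  {d : LambdaMetric Λ X} {G : Type*} [Group G] {N : Subgroup G}

theorem hyperbolicLength_conj_of_affine (hX : d.IsTree) [Nonempty X] {g g' σ : Equiv.Perm X}
    {a : Λ ≃+o Λ} (hg : d.IsIsometric g) (hg' : d.IsIsometric g')
    (hσ : ∀ x y, d.dist (σ x) (σ y) = a (d.dist x y)) (hconj : ∀ x, g' (σ x) = σ (g x)) :
    d.hyperbolicLength g' = a (d.hyperbolicLength g) := by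
  let x : X := Classical.arbitrary X
  rw [hX.hyperbolicLength_eq hg' (σ x), hX.hyperbolicLength_eq hg x, hconj, hconj, hσ, hσ,
    map_max_aut, map_sub, map_zero]

theorem exists_affine_of_length (hX : d.IsTree) (hN : N.Normal) {ρ : N →* Equiv.Perm X}
    (hiso : d.IsIsometricAction ρ) (hmin : d.IsMinimalAction ρ) (hnonab : ¬ d.IsAbelianAction ρ)
    (hdih : d.IsDihedralAction ρ → ∀ g : N, ¬ IsInversion (ρ g)) {a : Λ ≃+o Λ} {γ : G}
    (hℓ : ∀ g : N, d.hyperbolicLength (ρ ⟨γ * (g : G) * γ⁻¹, hN.conj_mem (g : G) g.2 γ⟩) =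
      a (d.hyperbolicLength (ρ g))) :
    ∃ φ : Equiv.Perm X, (∀ x y, d.dist (φ x) (φ y) = a (d.dist x y)) ∧
      ∀ (g : N) x, φ (ρ g x) = ρ ⟨γ * (g : G) * γ⁻¹, hN.conj_mem (g : G) g.2 γ⟩ (φ x) := by
  have : Nonempty X := nonempty_of_not_isAbelianAction hnonab
  let c : N →* N := (MulAut.conjNormal γ : MulAut N).toMonoidHom
  have hc : ∀ g : N, c g = ⟨γ * (g : G) * γ⁻¹, hN.conj_mem (g : G) g.2 γ⟩ := fun g => rfl
  have hcs : ∀ g : N, ∃ h, c h = g := (MulAut.conjNormal γ : MulAut N).surjective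
  have hlen : ∀ g, (d.rescale a).hyperbolicLength (ρ g) = a (d.hyperbolicLength (ρ g)) :=
    fun g => hX.hyperbolicLength_rescale (hiso g)
  have hlen' : ∀ g, d.hyperbolicLength (ρ.comp c g) = (d.rescale a).hyperbolicLength (ρ g) := by
    intro g
    rw [hlen, ← hℓ]
    rfl
  have hiso' : d.IsIsometricAction (ρ.comp c) := fun g => hiso (c g)
  have hisoa : (d.rescale a).IsIsometricAction ρ := fun g x y => congrArg a (hiso g x y)
  have hmin' : d.IsMinimalAction (ρ.comp c) := by
    intro S hne hS hinv
    refine hmin S hne hS fun g x hx => ?_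
    obtain ⟨h, rfl⟩ := hcs g
    exact hinv h x hx
  have hab : ∃ g h, d.hyperbolicLength (ρ g) + d.hyperbolicLength (ρ h) <
      d.hyperbolicLength (ρ (g * h)) := by
    unfold IsAbelianAction at hnonab
    push Not at hnonab
    exact hnonab
  -- Twisting by the surjection `c` and rescaling create no new dihedral actions, so the absence of
  -- inversions carries over.
  have hdih' : d.IsDihedralAction (ρ.comp c) → d.IsDihedralAction ρ := by
    rintro ⟨-, h⟩
    refine ⟨hnonab, fun s t hs ht => ?_⟩
    obtain ⟨s, rfl⟩ := hcs s
    obtain ⟨t, rfl⟩ := hcs t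
    rw [← map_mul c]
    exact h s t hs ht
  have hdiha : (d.rescale a).IsDihedralAction ρ → d.IsDihedralAction ρ := by
    rintro ⟨-, h⟩
    refine ⟨hnonab, fun s t hs ht => ?_⟩
    have := h s t hs ht
    rw [hlen, hlen, hlen, ← map_add] at this
    exact (OrderIsoClass.map_le_map_iff a).1 this
  obtain ⟨F, hF⟩ := exists_displacement_of_length (X := X)
    (ℓ := fun n => (d.rescale a).hyperbolicLength (ρ n)) (by
      obtain ⟨g, h, hgh⟩ := hab
      refine ⟨g, h, ?_⟩
      simp only [hlen]
      rw [← map_add]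
      exact (map_lt_map_iff a).2 hgh)
  obtain ⟨x, hx, -⟩ := hF (d.rescale a) ρ hX.rescale hisoa (fun h => hdih (hdiha h)) rfl
  obtain ⟨x', hx', -⟩ := hF d (ρ.comp c) hX hiso' (fun h n => hdih (hdih' h) (c n)) (funext hlen')
  obtain ⟨φ, h1, h2⟩ := hX.rescale.exists_equivariant_isometry hX hisoa hiso' hmin.rescale hmin'
    (x := x) (x' := x') (by
      intro n
      have := (hx n).trans (hx' n).symm
      grind)
  exact ⟨φ, h1, h2⟩

end LambdaMetric

open LambdaMetric in
theorem mainTheorem9 {Λ : Type*} [AddCommGroup Λ] [LinearOrder Λ] [IsOrderedAddMonoid Λ]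
    {X : Type*} (d : LambdaMetric Λ X) (hX : d.IsTree)
    {G : Type*} [Group G] (N : Subgroup G) (hN : N.Normal)
    (ρ : N →* Equiv.Perm X) (hiso : d.IsIsometricAction ρ)
    (hmin : d.IsMinimalAction ρ) (hnonab : ¬ d.IsAbelianAction ρ)
    (hdih : d.IsDihedralAction ρ → ∀ g : N, ¬ LambdaMetric.IsInversion (ρ g))
    (α : G →* (Λ ≃+o Λ)) (hα : N ≤ α.ker) :
    (∃ σ : G →* Equiv.Perm X, d.IsAffineAction α σ ∧ ∀ (g : N) (x : X), σ (g : G) x = ρ g x) ↔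
      ∀ (g : N) (γ : G),
        d.hyperbolicLength (ρ ⟨γ * (g : G) * γ⁻¹, hN.conj_mem (g : G) g.2 γ⟩) =
          α γ (d.hyperbolicLength (ρ g)) := by
  have : Nonempty X := nonempty_of_not_isAbelianAction hnonab
  constructor
  · rintro ⟨σ, hσ, hext⟩ g γ
    refine hyperbolicLength_conj_of_affine hX (hiso _) (hiso _) (hσ γ) fun x => ?_
    rw [← hext, ← hext, ← Equiv.Perm.mul_apply, ← Equiv.Perm.mul_apply, ← map_mul, ← map_mul]
    simp
  · intro hℓ
    choose φ hφ hφρ using fun γ =>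
      exists_affine_of_length hX hN hiso hmin hnonab hdih (a := α γ) (γ := γ) fun g => hℓ g γ
    -- The scalings and the twists cancel in `f'⁻¹ * f`, an isometry commuting with `N`.
    have huniq : ∀ {a : Λ ≃+o Λ} {γ : G} {f f' : Equiv.Perm X},
        (∀ x y, d.dist (f x) (f y) = a (d.dist x y)) →
        (∀ x y, d.dist (f' x) (f' y) = a (d.dist x y)) →
        (∀ (g : N) x, f (ρ g x) = ρ ⟨γ * (g : G) * γ⁻¹, hN.conj_mem (g : G) g.2 γ⟩ (f x)) →
        (∀ (g : N) x, f' (ρ g x) = ρ ⟨γ * (g : G) * γ⁻¹, hN.conj_mem (g : G) g.2 γ⟩ (f' x)) →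
        f = f' := by
      intro a γ f f' hf hf' hfρ hfρ'
      ext x
      have h1 : d.IsIsometric (f'⁻¹ * f) := by
        intro y z
        apply EmbeddingLike.injective a
        rw [← hf', ← hf]
        simp
      have h2 : ∀ n y, (f'⁻¹ * f) (ρ n y) = ρ n ((f'⁻¹ * f) y) := by
        intro n y
        apply f'.injective
        rw [hfρ']
        simp [hfρ]
      have h3 := eq_one_of_commute hX hiso hmin hnonab hdih h1 h2 x
      rw [Equiv.Perm.mul_apply, Equiv.Perm.inv_eq_iff_eq] at h3
      exact h3
    refine ⟨MonoidHom.mk' φ fun γ δ => huniq (hφ _) ?_ (hφρ _) ?_, hφ, fun g x => ?_⟩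
    · intro x y
      rw [Equiv.Perm.mul_apply, Equiv.Perm.mul_apply, hφ, hφ, map_mul]
      rfl
    · intro g x
      rw [Equiv.Perm.mul_apply, Equiv.Perm.mul_apply, hφρ, hφρ]
      congr 3
      simp [mul_assoc]
    · have hg : α (g : G) = 1 := hα g.2
      have h1 : φ (g : G) = ρ g := by
        refine huniq (hφ g) ?_ (hφρ g) ?_
        · intro x y
          rw [hg]
          exact hiso g x y
        · intro h x
          rw [← Equiv.Perm.mul_apply, ← Equiv.Perm.mul_apply, ← map_mul, ← map_mul]
          congr 2
          ext
          simp
      exact congrArg (fun f => f x) h1
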